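/- A topological quiver $\mathcal Q=(E^0,E^1,r,s,\lambda)$ consists of second countable locally compact Hausdorff spaces $E^0$, $E^1$, a continuous open map $r:E^1\to E^0$, a continuous map $s:E^1\to E^0$, and Radon measures $\lambda=\{\lambda_v\}_{v\in E^0}$ on $E^1$ such that $\operatorname{supp}\lambda_v=r^{-1}(v)$ for all $v$, and $v\mapsto\int_{E^1}\xi\,d\lambda_v$ belongs to $C_c(E^0)$ for every $\xi\in C_c(E^1)$. Let $A=C_0(E^0)$ and let $X$ be the associated $C^*$-correspondence over $A$: the completion of $C_c(E^1)$ in the norm given by the $A$-valued inner product $\langle\xi,\eta\rangle(v)=\int\overline{\xi}\,\eta\,d\lambda_v$, with right action $(\xi\cdot f)(\alpha)=\xi(\alpha)f(r(\alpha))$ and left action $(\phi(f)\xi)(\alpha)=f(s(\alpha))\xi(\alpha)$, extended by continuity. Let $\mathcal K(X)$ be the closed linear span (in operator norm) of the operators $\Theta_{x,y}:z\mapsto x\cdot\langle y,z\rangle$, $x,y\in X$; put $J(X)=\phi^{-1}(\mathcal K(X))$ and $J_X=J(X)\cap(\ker\phi)^\perp$, where $I^\perp=\{a\in A: ab=0\text{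 for all }b\in I\}$. For an open set $U\subseteq E^0$, identify $C_0(U)$ with $\{f\in A: f=0\text{ off }U\}$; to an ideal $I$ of $A$ attach the open set $\{v\in E^0: f(v)\neq 0\text{ for some }f\in I\}$. Let $E^0_{\rm sinks}$ and $E^0_{\rm fin}$ be the open sets attached to $\ker\phi$ and $J(X)$, and let $E^0_{\rm reg}=E^0_{\rm fin}\setminus\overline{E^0_{\rm sinks}}$. Then $E^0_{\rm sinks}$, $E^0_{\rm fin}$, $E^0_{\rm reg}$ are open, $\ker\phi=C_0(E^0_{\rm sinks})$, $J(X)=C_0(E^0_{\rm fin})$, $J_X=C_0(E^0_{\rm reg})$, and 1. $E^0_{\rm sinks}=E^0\setminus\overline{s(E^1)}$; 2. $E^0_{\rm fin}$ is the set of all $v\in E^0$ that have a neighbourhood $V$ such that $\overline V$ is compact, $s^{-1}(\overline V)$ is compact, and $r|_{s^{-1}(V)}:s^{-1}(V)\to E^0$ is a local homeomorphism; 3. $E^0_{\rm reg}$ is the intersection of the set in (2) with $\operatorname{Int}\overline{s(E^1)}$. -/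

import Mathlib

open MeasureTheory Topology Set
open scoped CompactlySupported ZeroAtInfty

noncomputable section

/-- A topological quiver with vertex space `E0` and edge space `E1`, both second countable locally
compact Hausdorff.  `lam v` is the Radon measure `λ_v` on the edge space. -/
structure TopologicalQuiver (E0 E1 : Type*)
    [TopologicalSpace E0] [T2Space E0] [LocallyCompactSpace E0] [SecondCountableTopology E0]
    [TopologicalSpace E1] [T2Space E1] [LocallyCompactSpace E1] [SecondCountableTopology E1]
    [MeasurableSpace E1] [BorelSpace E1] where
  /-- the range map -/
  r : E1 → E0
  /-- the source map -/
  s : E1 → E0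
  /-- the family of measures on the edge space -/
  lam : E0 → Measure E1
  continuous_r : Continuous r
  isOpenMap_r : IsOpenMap r
  continuous_s : Continuous s
  regular_lam : ∀ v, (lam v).Regular
  support_lam : ∀ v, (lam v).support = r ⁻¹' {v}
  continuous_integral : ∀ ξ : C_c(E1, ℂ), Continuous fun v => ∫ α, ξ α ∂(lam v)
  hasCompactSupport_integral : ∀ ξ : C_c(E1, ℂ), HasCompactSupport fun v => ∫ α, ξ α ∂(lam v)

namespace TopologicalQuiver

variable {E0 E1 : Type*}
  [TopologicalSpace E0] [T2Space E0] [LocallyCompactSpace E0] [SecondCountableTopology E0]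
  [TopologicalSpace E1] [T2Space E1] [LocallyCompactSpace E1] [SecondCountableTopology E1]
  [MeasurableSpace E1] [BorelSpace E1]

/-! ### The pre-Hilbert module of compactly supported functions -/

/-- `C_c(E¹)`, to be normed by the `C_0(E⁰)`-valued inner product of the quiver. -/
def PreModule (_Q : TopologicalQuiver E0 E1) : Type _ := C_c(E1, ℂ)

variable (Q : TopologicalQuiver E0 E1)

instance : AddCommGroup Q.PreModule := inferInstanceAs (AddCommGroup C_c(E1, ℂ))

instance : Module ℂ Q.PreModule := inferInstanceAs (Module ℂ C_c(E1, ℂ))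

instance : FunLike Q.PreModule E1 ℂ := inferInstanceAs (FunLike C_c(E1, ℂ) E1 ℂ)

variable {Q}

theorem PreModule.continuous (ξ : Q.PreModule) : Continuous ξ :=
  map_continuous (show C_c(E1, ℂ) from ξ)

theorem PreModule.hasCompactSupport (ξ : Q.PreModule) : HasCompactSupport ξ :=
  CompactlySupportedContinuousMap.hasCompactSupport (show C_c(E1, ℂ) from ξ)

theorem PreModule.add_apply (ξ η : Q.PreModule) (α : E1) : (ξ + η) α = ξ α + η α := rfl

theorem PreModule.smul_apply (c : ℂ) (ξ : Q.PreModule) (α : E1) : (c • ξ) α = c * ξ α := rfl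

@[ext]
theorem PreModule.ext {ξ η : Q.PreModule} (h : ∀ α, ξ α = η α) : ξ = η := DFunLike.ext _ _ h

/-- The compactly supported function `α ↦ conj (ξ α) * η α`. -/
def starMul (ξ η : Q.PreModule) : C_c(E1, ℂ) where
  toFun := fun α => star (ξ α) * η α
  continuous_toFun := ξ.continuous.star.mul η.continuous
  hasCompactSupport' := η.hasCompactSupport.mul_left

theorem integrable_starMul (ξ η : Q.PreModule) (v : E0) :
    Integrable (fun α => star (ξ α) * η α) (Q.lam v) := by
  have := Q.regular_lam v
  exact (starMul ξ η).continuous_toFun.integrable_of_hasCompactSupport (starMul ξ η).hasCompactSupport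

/-- `⟨ξ, η⟩ (v) = ∫ conj (ξ α) * η α ∂λ_v`; the measure `λ_v` is carried by `r⁻¹(v)`. -/
def preInner (ξ η : Q.PreModule) : C₀(E0, ℂ) where
  toFun := fun v => ∫ α, star (ξ α) * η α ∂(Q.lam v)
  continuous_toFun := Q.continuous_integral (starMul ξ η)
  zero_at_infty' := (Q.hasCompactSupport_integral (starMul ξ η)).is_zero_at_infty

theorem preInner_apply (ξ η : Q.PreModule) (v : E0) :
    preInner ξ η v = ∫ α, star (ξ α) * η α ∂(Q.lam v) := rfl

theorem star_preInner (ξ η : Q.PreModule) : star (preInner ξ η) = preInner η ξ := by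
  ext v
  rw [ZeroAtInftyContinuousMap.star_apply, preInner_apply, preInner_apply]
  change (starRingEnd ℂ) _ = _
  rw [← integral_conj]
  congr 1
  ext α
  simp [mul_comm]

theorem preInner_add_right (ξ η ζ : Q.PreModule) :
    preInner ξ (η + ζ) = preInner ξ η + preInner ξ ζ := by
  ext v
  rw [ZeroAtInftyContinuousMap.add_apply, preInner_apply, preInner_apply, preInner_apply,
    ← integral_add (integrable_starMul ξ η v) (integrable_starMul ξ ζ v)]
  congr 1
  ext α
  rw [PreModule.add_apply, mul_add]

theorem preInner_smul_right (c : ℂ) (ξ η : Q.PreModule) :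
    preInner ξ (c • η) = c • preInner ξ η := by
  ext v
  rw [ZeroAtInftyContinuousMap.smul_apply, preInner_apply, preInner_apply, smul_eq_mul,
    ← integral_const_mul]
  congr 1
  ext α
  rw [PreModule.smul_apply]
  ring

theorem preInner_add_left (ξ η ζ : Q.PreModule) :
    preInner (ξ + η) ζ = preInner ξ ζ + preInner η ζ := by
  rw [← star_preInner, preInner_add_right, star_add, star_preInner, star_preInner]

theorem preInner_smul_left (c : ℂ) (ξ η : Q.PreModule) :
    preInner (c • ξ) η = star c • preInner ξ η := by
  rw [← star_preInner, preInner_smul_right, star_smul, star_preInner]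

theorem preInner_self_apply (ξ : Q.PreModule) (v : E0) :
    preInner ξ ξ v = ((∫ α, ‖ξ α‖ ^ 2 ∂(Q.lam v) : ℝ) : ℂ) := by
  rw [preInner_apply, ← integral_complex_ofReal]
  congr 1
  ext α
  have := Complex.conj_mul' (ξ α)
  simpa using this

section

variable {Y : Type*} [TopologicalSpace Y]

theorem norm_apply_le (f : C₀(Y, ℂ)) (v : Y) : ‖f v‖ ≤ ‖f‖ := by
  rw [← ZeroAtInftyContinuousMap.norm_toBCF_eq_norm]
  exact f.toBCF.norm_coe_le_norm v

theorem norm_le_of_apply_le (f : C₀(Y, ℂ)) {C : ℝ} (hC : 0 ≤ C) (h : ∀ v, ‖f v‖ ≤ C) :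
    ‖f‖ ≤ C := by
  rw [← ZeroAtInftyContinuousMap.norm_toBCF_eq_norm]
  exact (BoundedContinuousFunction.norm_le hC).2 h

end

/-- The scalar semi-inner product given by evaluating at `v`. -/
@[reducible]
def coreAt (Q : TopologicalQuiver E0 E1) (v : E0) : PreInnerProductSpace.Core ℂ Q.PreModule where
  inner ξ η := preInner ξ η v
  conj_inner_symm ξ η := by rw [← star_preInner, ZeroAtInftyContinuousMap.star_apply]; exact star_star _
  re_inner_nonneg ξ := by
    rw [preInner_self_apply]
    exact integral_nonneg fun α => by positivity
  add_left ξ η ζ := by rw [preInner_add_left]; rfl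
  smul_left ξ η c := by rw [preInner_smul_left]; rfl

instance : Norm Q.PreModule := ⟨fun ξ => √‖preInner ξ ξ‖⟩

theorem PreModule.norm_def (ξ : Q.PreModule) : ‖ξ‖ = √‖preInner ξ ξ‖ := rfl

theorem PreModule.norm_sq (ξ : Q.PreModule) : ‖ξ‖ ^ 2 = ‖preInner ξ ξ‖ := by
  rw [PreModule.norm_def, Real.sq_sqrt (norm_nonneg _)]

theorem norm_preInner_le (ξ η : Q.PreModule) : ‖preInner ξ η‖ ≤ ‖ξ‖ * ‖η‖ := by
  refine norm_le_of_apply_le _ (mul_nonneg (Real.sqrt_nonneg _) (Real.sqrt_nonneg _)) fun v => ?_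
  have key := @InnerProductSpace.Core.norm_inner_le_norm ℂ Q.PreModule _ _ _ (Q.coreAt v) ξ η
  have aux : ∀ ζ : Q.PreModule, √(RCLike.re (preInner ζ ζ v)) ≤ ‖ζ‖ := fun ζ =>
    Real.sqrt_le_sqrt ((RCLike.re_le_norm _).trans (norm_apply_le _ v))
  exact key.trans (mul_le_mul (aux ξ) (aux η) (Real.sqrt_nonneg _) (Real.sqrt_nonneg _))

theorem PreModule.core : SeminormedSpace.Core ℂ Q.PreModule where
  norm_nonneg _ := Real.sqrt_nonneg _
  norm_smul c ξ := by
    rw [PreModule.norm_def, PreModule.norm_def, preInner_smul_left, preInner_smul_right, norm_smul,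
      norm_smul, norm_star, ← mul_assoc, Real.sqrt_mul (by positivity),
      Real.sqrt_mul_self (norm_nonneg _)]
  norm_triangle ξ η := by
    have h0 : 0 ≤ ‖ξ‖ := Real.sqrt_nonneg _
    have h1 : 0 ≤ ‖η‖ := Real.sqrt_nonneg _
    refine le_of_sq_le_sq ?_ (add_nonneg h0 h1)
    rw [PreModule.norm_sq, preInner_add_left, preInner_add_right, preInner_add_right]
    have t1 := norm_add_le (preInner ξ ξ + preInner ξ η) (preInner η ξ + preInner η η)
    have t2 := norm_add_le (preInner ξ ξ) (preInner ξ η)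
    have t3 := norm_add_le (preInner η ξ) (preInner η η)
    have c1 := norm_preInner_le ξ η
    have c2 := norm_preInner_le η ξ
    have s1 := PreModule.norm_sq ξ
    have s2 := PreModule.norm_sq η
    nlinarith

instance : SeminormedAddCommGroup Q.PreModule := SeminormedAddCommGroup.ofCore PreModule.core

instance : NormedSpace ℂ Q.PreModule where
  norm_smul_le c ξ := (PreModule.core.norm_smul c ξ).le

/-- Multiplication of `ξ` by `f ∘ h`, for a continuous map `h` from edges to vertices. -/
def preMul (h : C(E1, E0)) (f : C₀(E0, ℂ)) (ξ : Q.PreModule) : Q.PreModule :=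
  show C_c(E1, ℂ) from
    { toFun := fun α => f (h α) * ξ α
      continuous_toFun := ((map_continuous f).comp h.continuous).mul ξ.continuous
      hasCompactSupport' := ξ.hasCompactSupport.mul_left }

theorem preMul_apply (h : C(E1, E0)) (f : C₀(E0, ℂ)) (ξ : Q.PreModule) (α : E1) :
    preMul h f ξ α = f (h α) * ξ α := rfl

theorem norm_preMul_le (h : C(E1, E0)) (f : C₀(E0, ℂ)) (ξ : Q.PreModule) :
    ‖preMul h f ξ‖ ≤ ‖f‖ * ‖ξ‖ := by
  refine le_of_sq_le_sq ?_ (by positivity)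
  rw [PreModule.norm_sq, mul_pow, PreModule.norm_sq]
  refine norm_le_of_apply_le _ (by positivity) fun v => ?_
  have hI : ∀ ζ : Q.PreModule, Integrable (fun α => ‖ζ α‖ ^ 2) (Q.lam v) := fun ζ => by
    refine (integrable_starMul ζ ζ v).norm.congr (Filter.Eventually.of_forall fun α => ?_)
    simp [sq]
  have hn : ∀ ζ : Q.PreModule, ‖preInner ζ ζ v‖ = ∫ α, ‖ζ α‖ ^ 2 ∂(Q.lam v) := fun ζ => by
    rw [preInner_self_apply, Complex.norm_real, Real.norm_of_nonneg]
    exact integral_nonneg fun α => by positivity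
  calc ‖preInner (preMul h f ξ) (preMul h f ξ) v‖
      = ∫ α, ‖preMul h f ξ α‖ ^ 2 ∂(Q.lam v) := hn _
    _ ≤ ∫ α, ‖f‖ ^ 2 * ‖ξ α‖ ^ 2 ∂(Q.lam v) := by
        refine integral_mono (hI _) ((hI ξ).const_mul _) fun α => ?_
        simp only [preMul_apply, norm_mul, mul_pow]
        have := norm_apply_le f (h α)
        gcongr
    _ = ‖f‖ ^ 2 * ‖preInner ξ ξ v‖ := by rw [integral_const_mul, hn]
    _ ≤ ‖f‖ ^ 2 * ‖preInner ξ ξ‖ := by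
        have := norm_apply_le (preInner ξ ξ) v
        gcongr

/-- The inner product on `C_c(E¹)` as a bounded sesquilinear map. -/
def preInnerL (Q : TopologicalQuiver E0 E1) :
    Q.PreModule →L⋆[ℂ] Q.PreModule →L[ℂ] C₀(E0, ℂ) :=
  LinearMap.mkContinuous₂
    (LinearMap.mk₂'ₛₗ (starRingEnd ℂ) (RingHom.id ℂ) (fun ξ η : Q.PreModule => preInner ξ η)
      preInner_add_left preInner_smul_left preInner_add_right
      (fun c ξ η => preInner_smul_right c ξ η))
    1 (fun ξ η => by simpa using norm_preInner_le ξ η)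

/-- The map `(ξ, f) ↦ (f ∘ h) ξ` on `C_c(E¹) × C_0(E⁰)` as a bounded bilinear map. -/
def preMulL (Q : TopologicalQuiver E0 E1) (h : C(E1, E0)) :
    Q.PreModule →L[ℂ] C₀(E0, ℂ) →L[ℂ] Q.PreModule :=
  LinearMap.mkContinuous₂
    (LinearMap.mk₂ ℂ (fun (ξ : Q.PreModule) f => preMul h f ξ)
      (fun ξ η f => PreModule.ext fun α => by simp [preMul_apply, PreModule.add_apply, mul_add])
      (fun c ξ f => PreModule.ext fun α => by
        simp only [preMul_apply, PreModule.smul_apply]; ring)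
      (fun ξ f g => PreModule.ext fun α => by
        simp [preMul_apply, PreModule.add_apply, add_mul])
      (fun c ξ f => PreModule.ext fun α => by
        simp [preMul_apply, PreModule.smul_apply, mul_assoc]))
    1 (fun ξ f => by simpa [mul_comm] using norm_preMul_le h f ξ)

/-! ### The correspondence `X` -/

/-- The Hilbert module `X`: the completion of `C_c(E¹)`. -/
abbrev Corr (Q : TopologicalQuiver E0 E1) : Type _ := UniformSpace.Completion Q.PreModule

/-- The canonical map `C_c(E¹) → X`. -/
def toCorr (Q : TopologicalQuiver E0 E1) : Q.PreModule →L[ℂ] Q.Corr :=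
  UniformSpace.Completion.toComplL

theorem denseRange_toCorr : DenseRange Q.toCorr := UniformSpace.Completion.denseRange_coe

theorem isUniformInducing_toCorr : IsUniformInducing Q.toCorr :=
  UniformSpace.Completion.isUniformInducing_coe _

/-- The `C_0(E⁰)`-valued inner product on `X`, extended by continuity from `C_c(E¹)`. -/
def innerX (Q : TopologicalQuiver E0 E1) : Q.Corr →L⋆[ℂ] Q.Corr →L[ℂ] C₀(E0, ℂ) :=
  ((Q.preInnerL.extend Q.toCorr).flip.extend Q.toCorr).flip

theorem innerX_toCorr (ξ η : Q.PreModule) :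
    Q.innerX (Q.toCorr ξ) (Q.toCorr η) = preInner ξ η := by
  rw [innerX, ContinuousLinearMap.flip_apply,
    ContinuousLinearMap.extend_eq _ denseRange_toCorr isUniformInducing_toCorr,
    ContinuousLinearMap.flip_apply,
    ContinuousLinearMap.extend_eq _ denseRange_toCorr isUniformInducing_toCorr]
  rfl

/-- The map `(x, f) ↦ (f ∘ h) x` on `X × C_0(E⁰)`, extended by continuity from `C_c(E¹)`. -/
def mulX (Q : TopologicalQuiver E0 E1) (h : C(E1, E0)) : Q.Corr →L[ℂ] C₀(E0, ℂ) →L[ℂ] Q.Corr :=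
  ((ContinuousLinearMap.compL ℂ C₀(E0, ℂ) Q.PreModule Q.Corr Q.toCorr).comp
    (Q.preMulL h)).extend Q.toCorr

theorem mulX_toCorr (h : C(E1, E0)) (ξ : Q.PreModule) (f : C₀(E0, ℂ)) :
    Q.mulX h (Q.toCorr ξ) f = Q.toCorr (preMul h f ξ) := by
  rw [mulX, ContinuousLinearMap.extend_eq _ denseRange_toCorr isUniformInducing_toCorr]
  rfl

/-- The right action, `(ξ · f) (α) = ξ α * f (r α)` on `C_c(E¹)`. -/
def rightAction (Q : TopologicalQuiver E0 E1) : Q.Corr →L[ℂ] C₀(E0, ℂ) →L[ℂ] Q.Corr :=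
  Q.mulX ⟨Q.r, Q.continuous_r⟩

/-- The left action `φ`, `(φ(f) ξ) (α) = f (s α) * ξ α` on `C_c(E¹)`. -/
def φ (Q : TopologicalQuiver E0 E1) : C₀(E0, ℂ) →L[ℂ] (Q.Corr →L[ℂ] Q.Corr) :=
  (Q.mulX ⟨Q.s, Q.continuous_s⟩).flip

theorem rightAction_toCorr (ξ : Q.PreModule) (f : C₀(E0, ℂ)) :
    Q.rightAction (Q.toCorr ξ) f = Q.toCorr (preMul ⟨Q.r, Q.continuous_r⟩ f ξ) :=
  mulX_toCorr _ ξ f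

theorem φ_toCorr (f : C₀(E0, ℂ)) (ξ : Q.PreModule) :
    Q.φ f (Q.toCorr ξ) = Q.toCorr (preMul ⟨Q.s, Q.continuous_s⟩ f ξ) :=
  mulX_toCorr _ ξ f

/-- `T` is adjointable, with adjoint `S`. -/
def IsAdjointPair (T S : Q.Corr →L[ℂ] Q.Corr) : Prop :=
  ∀ x y, Q.innerX (T x) y = Q.innerX x (S y)

/-- The operator `Θ_{x,y} (z) = x · ⟨y, z⟩`. -/
def theta (x y : Q.Corr) : Q.Corr →L[ℂ] Q.Corr := (Q.rightAction x).comp (Q.innerX y)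

theorem theta_apply (x y z : Q.Corr) : theta x y z = Q.rightAction x (Q.innerX y z) := rfl

/-- `K(X)`: the closed linear span of the operators `Θ_{x,y}`, in the operator norm. -/
def compacts (Q : TopologicalQuiver E0 E1) : Submodule ℂ (Q.Corr →L[ℂ] Q.Corr) :=
  (Submodule.span ℂ {T | ∃ x y : Q.Corr, T = theta x y}).topologicalClosure

/-! #### The laws of a C*-correspondence -/

theorem corr_induction {p : Q.Corr → Prop} (x : Q.Corr) (hc : IsClosed {x | p x})
    (h : ∀ ξ, p (Q.toCorr ξ)) : p x :=
  denseRange_toCorr.induction_on x hc h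

theorem star_innerX (x y : Q.Corr) : star (Q.innerX x y) = Q.innerX y x := by
  induction x using corr_induction with
  | hc => exact isClosed_eq (by fun_prop) (by fun_prop)
  | h ξ =>
    induction y using corr_induction with
    | hc => exact isClosed_eq (by fun_prop) (by fun_prop)
    | h η => rw [innerX_toCorr, innerX_toCorr, star_preInner]

theorem norm_sq_eq (x : Q.Corr) : ‖x‖ ^ 2 = ‖Q.innerX x x‖ := by
  induction x using corr_induction with
  | hc => exact isClosed_eq (by fun_prop) (by fun_prop)
  | h ξ =>
    rw [innerX_toCorr, ← PreModule.norm_sq]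
    congr 1
    exact UniformSpace.Completion.norm_coe ξ

theorem innerX_self_nonneg (x : Q.Corr) (v : E0) :
    0 ≤ (Q.innerX x x v).re ∧ (Q.innerX x x v).im = 0 := by
  have hev : Continuous fun f : C₀(E0, ℂ) => f v :=
    (continuous_eval_const (F := BoundedContinuousFunction E0 ℂ) v).comp
      (ZeroAtInftyContinuousMap.isometry_toBCF (α := E0) (β := ℂ)).continuous
  have hx : Continuous fun x : Q.Corr => Q.innerX x x v := hev.comp (by fun_prop)
  induction x using corr_induction with
  | hc =>
    exact (isClosed_le continuous_const (Complex.continuous_re.comp hx)).inter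
      (isClosed_eq (Complex.continuous_im.comp hx) continuous_const)
  | h ξ =>
    rw [innerX_toCorr, preInner_self_apply]
    exact ⟨integral_nonneg fun α => by positivity, Complex.ofReal_im _⟩

theorem φ_mul (f g : C₀(E0, ℂ)) : Q.φ (f * g) = (Q.φ f).comp (Q.φ g) := by
  ext x
  induction x using corr_induction with
  | hc => exact isClosed_eq (by fun_prop) (by fun_prop)
  | h ξ =>
    rw [ContinuousLinearMap.comp_apply, φ_toCorr, φ_toCorr, φ_toCorr]
    congr 1
    ext α
    simp [preMul_apply, mul_assoc]

theorem φ_adjoint (f : C₀(E0, ℂ)) : IsAdjointPair (Q.φ f) (Q.φ (star f)) := by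
  intro x y
  induction x using corr_induction with
  | hc => exact isClosed_eq (by fun_prop) (by fun_prop)
  | h ξ =>
    induction y using corr_induction with
    | hc => exact isClosed_eq (by fun_prop) (by fun_prop)
    | h η =>
      rw [φ_toCorr, φ_toCorr, innerX_toCorr, innerX_toCorr]
      ext v
      rw [preInner_apply, preInner_apply]
      congr 1
      ext α
      simp only [preMul_apply, ZeroAtInftyContinuousMap.star_apply, star_mul']
      ring

theorem rightAction_mul (x : Q.Corr) (f g : C₀(E0, ℂ)) :
    Q.rightAction x (f * g) = Q.rightAction (Q.rightAction x f) g := by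
  induction x using corr_induction with
  | hc => exact isClosed_eq (by fun_prop) (by fun_prop)
  | h ξ =>
    rw [rightAction_toCorr, rightAction_toCorr, rightAction_toCorr]
    congr 1
    ext α
    simp only [preMul_apply, ZeroAtInftyContinuousMap.mul_apply]
    ring

theorem innerX_rightAction (x y : Q.Corr) (f : C₀(E0, ℂ)) :
    Q.innerX x (Q.rightAction y f) = Q.innerX x y * f := by
  induction x using corr_induction with
  | hc => exact isClosed_eq (by fun_prop) (by fun_prop)
  | h ξ =>
    induction y using corr_induction with
    | hc => exact isClosed_eq (by fun_prop) (by fun_prop)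
    | h η =>
      rw [rightAction_toCorr, innerX_toCorr, innerX_toCorr]
      ext v
      rw [ZeroAtInftyContinuousMap.mul_apply, preInner_apply, preInner_apply,
        ← integral_mul_const]
      have hsupp : ∀ᵐ α ∂(Q.lam v), Q.r α = v := by
        have := Measure.support_mem_ae (μ := Q.lam v)
        rw [Q.support_lam v] at this
        exact this
      refine integral_congr_ae (hsupp.mono fun α hα => ?_)
      simp only [preMul_apply, ContinuousMap.coe_mk, hα]
      ring

/-! ### Ideals and special sets of vertices -/

/-- `ker φ`. -/
def kerφ (Q : TopologicalQuiver E0 E1) : Set C₀(E0, ℂ) := {f | Q.φ f = 0}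

/-- `J(X) = φ⁻¹(K(X))`. -/
def J (Q : TopologicalQuiver E0 E1) : Set C₀(E0, ℂ) := {f | Q.φ f ∈ Q.compacts}

/-- The annihilator `I^⊥` of `I` in `C_0(E⁰)`. -/
def annihilator (I : Set C₀(E0, ℂ)) : Set C₀(E0, ℂ) := {f | ∀ g ∈ I, f * g = 0}

/-- `J_X = J(X) ∩ (ker φ)^⊥`. -/
def JX (Q : TopologicalQuiver E0 E1) : Set C₀(E0, ℂ) := Q.J ∩ annihilator Q.kerφ

/-- The open set attached to an ideal `I` of `C_0(E⁰)`: the complement of the common zero set. -/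
def openSet (I : Set C₀(E0, ℂ)) : Set E0 := {v | ∀ f ∈ I, f v = 0}ᶜ

/-- `C_0(U)`, regarded as the ideal of functions in `C_0(E⁰)` which vanish off `U`. -/
def idealOf (U : Set E0) : Set C₀(E0, ℂ) := {f | ∀ v, v ∉ U → f v = 0}

/-- The sinks: the open set attached to `ker φ`. -/
def sinks (Q : TopologicalQuiver E0 E1) : Set E0 := openSet Q.kerφ

/-- The finite emitters: the open set attached to `φ⁻¹(K(X))`. -/
def fin (Q : TopologicalQuiver E0 E1) : Set E0 := openSet Q.J

/-- The regular vertices. -/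
def reg (Q : TopologicalQuiver E0 E1) : Set E0 := Q.fin \ closure Q.sinks

end TopologicalQuiver

end

noncomputable section

namespace TopologicalQuiver

variable {E0 E1 : Type*}
  [TopologicalSpace E0] [T2Space E0] [LocallyCompactSpace E0] [SecondCountableTopology E0]
  [TopologicalSpace E1] [T2Space E1] [LocallyCompactSpace E1] [SecondCountableTopology E1]
  [MeasurableSpace E1] [BorelSpace E1] {Q : TopologicalQuiver E0 E1}

/-! ### Bump functions and integration along the fibres -/

/-! Since `λ_v` has full support on `r⁻¹(v)`, the inner product is definite on `C_c(E¹)`, so `φ(f) =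
0` exactly when `f ∘ s = 0`. This gives the sinks, and the annihilator of `C_0(U)` consists of the
functions vanishing on the closure of `U`. The substance is the equality of `J(X)` with the ideal of
the finite emitters.

One inclusion is explicit (`mem_J_of_locallyInjective`). On a set where `r` is injective,
integrating over a fibre only sees one edge, so multiplication by a function supported there is a
single `Θ`. If `f ∘ s` lives in a compact set near which `r` is locally injective, a partition of
unity writes `φ(f)` as a finite sum of such operators. The general `f` follows by cutting off, as
`J(X)` is closed.

Conversely, a compact `φ(f)` is within `ε` of an integral operator with kernel `k` in `C_c(E¹ ×
E¹)`, and right linearity turns the norm estimate into one on every fibre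
(`exists_kernel_of_mem_J`). Two kinds of test functions exploit this. A bump away from the first
projection of the support of `k` is killed by the integral operator, so `|f ∘ s|` must be small
there (`isCompact_of_mem_J`). If `r` identified two edges arbitrarily near `α`, a function of mean
zero on that fibre, supported where `k` is almost constant, would nearly be killed, forcing `f(s(α))
= 0` (`exists_injOn_of_mem_J`). As `r` is open, local injectivity is the same as being a local
homeomorphism. -/

instance regular_lam_inst (v : E0) : (Q.lam v).Regular := Q.regular_lam v

/-- A bump function as an element of `C_0`. -/
theorem exists_zeroAtInfty_bump {Y : Type*} [TopologicalSpace Y] [T2Space Y]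
    [LocallyCompactSpace Y] {K U : Set Y} (hK : IsCompact K) (hU : IsOpen U) (hKU : K ⊆ U) :
    ∃ g : C₀(Y, ℂ), (∀ v ∈ K, g v = 1) ∧ (∀ v, ‖g v‖ ≤ 1) ∧ (∀ v, ‖1 - g v‖ ≤ 1) ∧
      ∃ L, IsCompact L ∧ L ⊆ U ∧ ∀ v, v ∉ L → g v = 0 := by
  obtain ⟨g, h1, hc, hs, h01⟩ := exists_continuousMap_one_of_isCompact_subset_isOpen hK hU hKU
  have hc' : HasCompactSupport fun v => ((g v : ℝ) : ℂ) :=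
    HasCompactSupport.comp_left (g := fun x : ℝ => (x : ℂ)) hc Complex.ofReal_zero
  refine ⟨⟨⟨fun v => (g v : ℂ), by fun_prop⟩, hc'.is_zero_at_infty⟩, fun v hv => ?_, fun v => ?_,
    fun v => ?_, tsupport g, hc, hs, fun v hv => ?_⟩
  · change ((g v : ℝ) : ℂ) = 1
    rw [h1 hv]; simp
  · change ‖((g v : ℝ) : ℂ)‖ ≤ 1
    rw [Complex.norm_real, Real.norm_of_nonneg (h01 v).1]
    exact (h01 v).2
  · change ‖1 - ((g v : ℝ) : ℂ)‖ ≤ 1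
    rw [← Complex.ofReal_one, ← Complex.ofReal_sub, Complex.norm_real,
      Real.norm_of_nonneg (sub_nonneg.2 (h01 v).2)]
    linarith [(h01 v).1]
  · change ((g v : ℝ) : ℂ) = 0
    rw [image_eq_zero_of_notMem_tsupport hv]; simp

/-- A continuous function with compact support as an element of the pre-Hilbert module. -/
def mkPre (Q : TopologicalQuiver E0 E1) (g : E1 → ℂ) (hg : Continuous g)
    (hc : HasCompactSupport g) : Q.PreModule :=
  show C_c(E1, ℂ) from ⟨⟨g, hg⟩, hc⟩

/-- A real function with compact support as an element of the pre-Hilbert module. -/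
def ofRealPre (Q : TopologicalQuiver E0 E1) (g : C(E1, ℝ)) (hg : HasCompactSupport g) :
    Q.PreModule :=
  Q.mkPre (fun α => (g α : ℂ)) (by fun_prop)
    (HasCompactSupport.comp_left (g := fun x : ℝ => (x : ℂ)) hg Complex.ofReal_zero)

theorem ofRealPre_apply (g : C(E1, ℝ)) (hg : HasCompactSupport g) (α : E1) :
    Q.ofRealPre g hg α = (g α : ℂ) := rfl

theorem ae_r_eq (v : E0) : ∀ᵐ α ∂(Q.lam v), Q.r α = v := by
  have := Measure.support_mem_ae (μ := Q.lam v)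
  rw [Q.support_lam v] at this
  exact this

theorem integral_lam_pos {g : E1 → ℝ} (hg : Continuous g) (hc : HasCompactSupport g)
    (h0 : ∀ α, 0 ≤ g α) {α : E1} (hα : g α ≠ 0) : 0 < ∫ β, g β ∂(Q.lam (Q.r α)) := by
  rw [integral_pos_iff_support_of_nonneg h0 (hg.integrable_of_hasCompactSupport hc)]
  have hs : α ∈ (Q.lam (Q.r α)).support := by rw [Q.support_lam]; rfl
  exact (Measure.mem_support_iff_forall α).1 hs _ (hg.isOpen_support.mem_nhds hα)

/-- The squared norm of `ξ` on the fibre over `v`. -/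
def fiberSq (ξ : Q.PreModule) (v : E0) : ℝ := ∫ α, ‖ξ α‖ ^ 2 ∂(Q.lam v)

theorem norm_preInner_self_apply (ξ : Q.PreModule) (v : E0) :
    ‖preInner ξ ξ v‖ = fiberSq ξ v := by
  rw [preInner_self_apply, Complex.norm_real, Real.norm_of_nonneg, fiberSq]
  exact integral_nonneg fun α => by positivity

theorem hasCompactSupport_norm_sq (ξ : Q.PreModule) : HasCompactSupport fun α => ‖ξ α‖ ^ 2 :=
  ξ.hasCompactSupport.comp_left (g := fun z : ℂ => ‖z‖ ^ 2) (by simp)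

theorem continuous_norm_sq (ξ : Q.PreModule) : Continuous fun α => ‖ξ α‖ ^ 2 :=
  ξ.continuous.norm.pow 2

theorem integrable_norm_sq (ξ : Q.PreModule) (v : E0) :
    Integrable (fun α => ‖ξ α‖ ^ 2) (Q.lam v) :=
  (continuous_norm_sq ξ).integrable_of_hasCompactSupport (hasCompactSupport_norm_sq ξ)

theorem fiberSq_pos {ξ : Q.PreModule} {α : E1} (h : ξ α ≠ 0) : 0 < fiberSq ξ (Q.r α) :=
  integral_lam_pos (continuous_norm_sq ξ) (hasCompactSupport_norm_sq ξ)
    (fun _ => by positivity) (by simpa using h)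

theorem toCorr_eq_zero {ξ : Q.PreModule} (h : Q.toCorr ξ = 0) (α : E1) : ξ α = 0 := by
  by_contra hα
  have h1 := fiberSq_pos hα
  rw [← norm_preInner_self_apply, ← innerX_toCorr, h] at h1
  simp at h1

/-! ### The kernel of the left action -/

/-- Testing on a bump at `α` detects `f (s α)`, because a compactly supported function of norm zero
vanishes everywhere; the converse extends from `C_c(E¹)` by density. -/
theorem φ_eq_zero_iff (f : C₀(E0, ℂ)) : Q.φ f = 0 ↔ ∀ α, f (Q.s α) = 0 := by
  constructor
  · intro h α
    obtain ⟨g, h1, hc, -, -⟩ := exists_continuousMap_one_of_isCompact_subset_isOpen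
      (isCompact_singleton (x := α)) isOpen_univ (subset_univ _)
    have hc : HasCompactSupport g := hc
    have h2 : Q.toCorr (preMul ⟨Q.s, Q.continuous_s⟩ f (Q.ofRealPre g hc)) = 0 := by
      rw [← φ_toCorr, h]; rfl
    have h3 := toCorr_eq_zero h2 α
    rw [preMul_apply, ofRealPre_apply, h1 rfl] at h3
    simpa using h3
  · intro h
    ext x
    induction x using corr_induction with
    | hc => exact isClosed_eq (by fun_prop) (by fun_prop)
    | h ξ =>
      rw [φ_toCorr]
      have : preMul ⟨Q.s, Q.continuous_s⟩ f ξ = 0 := PreModule.ext fun α => by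
        rw [preMul_apply]
        change f (Q.s α) * _ = 0
        rw [h, zero_mul]
      rw [this]; simp

theorem openSet_idealOf {Y : Type*} [TopologicalSpace Y] [T2Space Y] [LocallyCompactSpace Y]
    [SecondCountableTopology Y] {U : Set Y} (hU : IsOpen U) : openSet (idealOf U) = U := by
  ext v
  constructor
  · intro hv
    by_contra hvU
    exact hv fun f hf => hf v hvU
  · intro hv h
    obtain ⟨g, h1, -, -, L, -, hLU, hL⟩ := exists_zeroAtInfty_bump (isCompact_singleton (x := v)) hU
      (singleton_subset_iff.2 hv)
    have h2 := h g fun w hw => hL w fun hwL => hw (hLU hwL)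
    rw [h1 v rfl] at h2
    exact one_ne_zero h2

theorem kerφ_eq (Q : TopologicalQuiver E0 E1) : Q.kerφ = idealOf (closure (range Q.s))ᶜ := by
  ext f
  rw [kerφ, mem_ofPred_eq, φ_eq_zero_iff]
  constructor
  · intro h v hv
    have hcl : IsClosed {w | f w = 0} := isClosed_eq (map_continuous f) continuous_const
    exact closure_minimal (t := {w | f w = 0}) (by rintro _ ⟨α, rfl⟩; exact h α) hcl
      (not_not.1 hv)
  · intro h α
    exact h _ fun hn => hn (subset_closure ⟨α, rfl⟩)

theorem sinks_eq (Q : TopologicalQuiver E0 E1) : Q.sinks = (closure (range Q.s))ᶜ := by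
  rw [sinks, kerφ_eq, openSet_idealOf isClosed_closure.isOpen_compl]

/-- At each point of `U` some member of `C_0(U)` is nonzero, so an annihilating function vanishes on
`U`, hence on its closure by continuity. -/
theorem annihilator_idealOf {U : Set E0} (hU : IsOpen U) :
    annihilator (idealOf U) = idealOf (closure U)ᶜ := by
  ext f
  constructor
  · intro h v hv
    have hcl : IsClosed {w | f w = 0} := isClosed_eq (map_continuous f) continuous_const
    refine closure_minimal (t := {w | f w = 0}) (fun w hw => ?_) hcl (not_not.1 hv)
    by_contra hfw
    rw [← openSet_idealOf hU] at hw
    refine hw fun g hg => ?_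
    have h1 := DFunLike.congr_fun (h g hg) w
    rw [ZeroAtInftyContinuousMap.mul_apply] at h1
    exact (mul_eq_zero.1 h1).resolve_left hfw
  · intro h g hg
    ext v
    rw [ZeroAtInftyContinuousMap.mul_apply]
    by_cases hv : v ∈ U
    · rw [h v fun hn => hn (subset_closure hv)]; simp
    · rw [hg v hv]; simp

/-! ### Functions supported on finite emitters act by compact operators -/

theorem theta_mem_compacts (x y : Q.Corr) : theta x y ∈ Q.compacts :=
  Submodule.le_topologicalClosure _ (Submodule.subset_span ⟨x, y, rfl⟩)

theorem theta_toCorr (ξ η ζ : Q.PreModule) :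
    theta (Q.toCorr ξ) (Q.toCorr η) (Q.toCorr ζ) =
      Q.toCorr (preMul ⟨Q.r, Q.continuous_r⟩ (preInner η ζ) ξ) := by
  rw [theta_apply, innerX_toCorr, rightAction_toCorr]

theorem isClosed_J (Q : TopologicalQuiver E0 E1) : IsClosed Q.J :=
  (Submodule.isClosed_topologicalClosure _).preimage Q.φ.continuous

/-- Where `r` is injective, an operator `Θ` acts as a multiplication operator. -/
theorem preInner_apply_of_injOn {U : Set E1} (hU : InjOn Q.r U) {η : Q.PreModule}
    (hη : ∀ β, β ∉ U → η β = 0) (ξ : Q.PreModule) {α : E1} (hα : α ∈ U) :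
    preInner η ξ (Q.r α) = (∫ β, star (η β) ∂(Q.lam (Q.r α))) * ξ α := by
  rw [preInner_apply, ← integral_mul_const]
  refine integral_congr_ae ((ae_r_eq (Q.r α)).mono fun β hβ => ?_)
  by_cases hβU : β ∈ U
  · rw [hU hβU hα hβ]
  · simp [hη β hβU]

/-- Multiplication by a function supported in a set where `r` is injective is of the form `Θ`. -/
theorem exists_theta_of_injOn {U : Set E1} (hUo : IsOpen U) (hU : InjOn Q.r U) (h : Q.PreModule)
    (hh : tsupport h ⊆ U) :
    ∃ ξ η : Q.PreModule, ∀ ζ : Q.PreModule, ∀ α,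
      preMul ⟨Q.r, Q.continuous_r⟩ (preInner η ζ) ξ α = h α * ζ α := by
  obtain ⟨g, h1, hc, hs, h01⟩ := exists_continuousMap_one_of_isCompact_subset_isOpen
    h.hasCompactSupport hUo hh
  have hc : HasCompactSupport g := hc
  set η := Q.ofRealPre g hc with hη
  have hηU : ∀ β, β ∉ U → η β = 0 := fun β hβ => by
    rw [hη, ofRealPre_apply, image_eq_zero_of_notMem_tsupport fun hn => hβ (hs hn)]; simp
  -- The fibre integral of `η` is the factor by which the pairing with `η` rescales a function; the
  -- witness `h / w` divides it out.
  set w : E1 → ℂ := fun α => ∫ β, η β ∂(Q.lam (Q.r α)) with hw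
  have hwc : Continuous w :=
    (Q.continuous_integral (show C_c(E1, ℂ) from η)).comp Q.continuous_r
  have hw0 : ∀ α ∈ tsupport h, w α ≠ 0 := fun α hα => by
    have h2 : w α = ((∫ β, g β ∂(Q.lam (Q.r α)) : ℝ) : ℂ) := by
      rw [← integral_complex_ofReal]; rfl
    rw [h2, Complex.ofReal_ne_zero]
    refine (integral_lam_pos g.continuous hc (fun β => (h01 β).1) (α := α) ?_).ne'
    rw [h1 hα]; exact one_ne_zero
  have hcont : Continuous fun α => h α / w α := by
    rw [continuous_iff_continuousAt]
    intro α
    by_cases hα : α ∈ tsupport h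
    · exact h.continuous.continuousAt.div hwc.continuousAt (hw0 α hα)
    -- Here `w` may vanish, but the quotient is locally zero.
    · have : (fun α => h α / w α) =ᶠ[𝓝 α] fun _ => 0 := by
        filter_upwards [(isClosed_tsupport h).isOpen_compl.mem_nhds hα] with β hβ
        rw [image_eq_zero_of_notMem_tsupport hβ, zero_div]
      exact continuousAt_const.congr this.symm
  have hcs : HasCompactSupport fun α => h α / w α := by
    simp only [div_eq_mul_inv]
    exact h.hasCompactSupport.mul_right
  refine ⟨Q.mkPre _ hcont hcs, η, fun ζ α => ?_⟩
  rw [preMul_apply]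
  change preInner η ζ (Q.r α) * (h α / w α) = h α * ζ α
  by_cases hα : α ∈ tsupport h
  · rw [preInner_apply_of_injOn hU hηU ζ (hh hα)]
    have h3 : (∫ β, star (η β) ∂(Q.lam (Q.r α))) = w α := by
      rw [hw]
      congr 1
      ext β
      rw [hη, ofRealPre_apply]
      exact Complex.conj_ofReal _
    rw [h3]
    field_simp [hw0 α hα]
  · rw [image_eq_zero_of_notMem_tsupport hα]; simp

/-- If `f ∘ s` is supported in a compact set near which `r` is locally injective, then `φ f` is
compact. -/
theorem mem_J_of_locallyInjective {f : C₀(E0, ℂ)} {C : Set E1} (hC : IsCompact C)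
    (hf : ∀ α, α ∉ C → f (Q.s α) = 0)
    (hr : ∀ α ∈ C, ∃ U, IsOpen U ∧ α ∈ U ∧ InjOn Q.r U) : f ∈ Q.J := by
  choose! U hUo hαU hUi using hr
  obtain ⟨t, htC, ht⟩ := hC.elim_nhds_subcover U fun α hα => (hUo α hα).mem_nhds (hαU α hα)
  let e := t.equivFin.symm
  obtain ⟨p, hps, hp1, -, hpc⟩ := exists_continuous_sum_one_of_isOpen_isCompact
    (s := fun i => U (e i)) (fun i => hUo _ (htC _ (e i).2)) hC (fun α hα => by
      obtain ⟨β, hβ, hαβ⟩ := mem_iUnion₂.1 (ht hα)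
      exact mem_iUnion.2 ⟨e.symm ⟨β, hβ⟩, by simpa using hαβ⟩)
  -- Each piece `(f ∘ s) p i` is supported where `r` is injective, so multiplication by it is one
  -- `Θ`; the pieces sum to `f ∘ s`, since the `p i` sum to `1` on `C` and `f ∘ s` vanishes off `C`.
  have key : ∀ i, ∃ ξ η : Q.PreModule, ∀ ζ : Q.PreModule, ∀ α,
      preMul ⟨Q.r, Q.continuous_r⟩ (preInner η ζ) ξ α = f (Q.s α) * (p i α : ℂ) * ζ α := fun i =>
    exists_theta_of_injOn (hUo _ (htC _ (e i).2)) (hUi _ (htC _ (e i).2))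
      (preMul ⟨Q.s, Q.continuous_s⟩ f (Q.ofRealPre (p i) (hpc i))) (by
        refine subset_trans ?_ (hps i)
        refine closure_mono fun α hα => ?_
        contrapose! hα
        rw [Function.notMem_support] at hα ⊢
        rw [preMul_apply, ofRealPre_apply, hα]; simp)
  choose ξ η h using key
  have hφ : Q.φ f = ∑ i, theta (Q.toCorr (ξ i)) (Q.toCorr (η i)) := by
    ext x
    induction x using corr_induction with
    | hc => exact isClosed_eq (by fun_prop) (by fun_prop)
    | h ζ =>
      rw [φ_toCorr, sum_apply]
      simp only [theta_toCorr]
      rw [← map_sum]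
      congr 1
      ext α
      have hs : (∑ i, preMul ⟨Q.r, Q.continuous_r⟩ (preInner (η i) ζ) (ξ i) : Q.PreModule) α
          = ∑ i, preMul ⟨Q.r, Q.continuous_r⟩ (preInner (η i) ζ) (ξ i) α :=
        map_sum (⟨⟨fun ξ : Q.PreModule => ξ α, rfl⟩, fun _ _ => rfl⟩ : Q.PreModule →+ ℂ) _ _
      rw [hs]
      simp only [h]
      rw [← Finset.sum_mul, ← Finset.mul_sum, preMul_apply]
      change f (Q.s α) * ζ α = _
      by_cases hα : α ∈ C
      · have h2 := hp1 hα
        rw [Finset.sum_apply, Pi.one_apply] at h2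
        rw [← Complex.ofReal_sum, h2]; simp
      · rw [hf α hα]; simp
  change Q.φ f ∈ Q.compacts
  rw [hφ]
  exact Submodule.sum_mem _ fun i _ => theta_mem_compacts _ _

/-- The finite emitters, described by the topology of the quiver. -/
def finiteEmitters (Q : TopologicalQuiver E0 E1) : Set E0 :=
  {v | ∃ V ∈ 𝓝 v, IsCompact (closure V) ∧ IsCompact (Q.s ⁻¹' closure V) ∧
      IsLocalHomeomorph ((Q.s ⁻¹' V).domRestrict Q.r)}

theorem isOpen_finiteEmitters (Q : TopologicalQuiver E0 E1) : IsOpen Q.finiteEmitters := by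
  rw [isOpen_iff_mem_nhds]
  rintro v ⟨V, hV, h⟩
  filter_upwards [interior_mem_nhds.2 hV] with w hw
  exact ⟨V, mem_interior_iff_mem_nhds.1 hw, h⟩

/-- `V` need not be open, but `s⁻¹(V)` is a neighbourhood of `α`, so chart domains in the subspace
are neighbourhoods in `E1`. -/
theorem exists_injOn_of_mem_finiteEmitters {α : E1} (h : Q.s α ∈ Q.finiteEmitters) :
    ∃ U, IsOpen U ∧ α ∈ U ∧ InjOn Q.r U := by
  obtain ⟨V, hV, -, -, hl⟩ := h
  have hVα : Q.s ⁻¹' V ∈ 𝓝 α := Q.continuous_s.continuousAt hV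
  obtain ⟨e, he, hee⟩ := hl ⟨α, mem_of_mem_nhds hVα⟩
  have hn : Subtype.val '' e.source ∈ 𝓝 α := by
    have := Filter.image_mem_map (m := Subtype.val) (e.open_source.mem_nhds he)
    rwa [map_nhds_subtype_coe_eq_nhds (mem_of_mem_nhds hVα) hVα] at this
  obtain ⟨U, hU, hUo, hα⟩ := mem_nhds_iff.1 hn
  refine ⟨U, hUo, hα, InjOn.mono hU ?_⟩
  rintro _ ⟨a, ha, rfl⟩ _ ⟨b, hb, rfl⟩ hab
  rw [e.injOn ha hb]
  rw [← hee]
  exact hab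

theorem isCompact_preimage_of_subset_finiteEmitters {K : Set E0} (hK : IsCompact K)
    (h : K ⊆ Q.finiteEmitters) : IsCompact (Q.s ⁻¹' K) := by
  have h' : ∀ v ∈ K, ∃ V ∈ 𝓝 v, IsCompact (Q.s ⁻¹' closure V) := fun v hv => by
    obtain ⟨V, hV, -, hc, -⟩ := h hv
    exact ⟨V, hV, hc⟩
  choose! V hV hc using h'
  obtain ⟨t, htK, ht⟩ := hK.elim_nhds_subcover V hV
  refine (t.isCompact_biUnion fun v hv => hc v (htK v hv)).of_isClosed_subset
    (hK.isClosed.preimage Q.continuous_s) fun α hα => ?_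
  obtain ⟨v, hv, hαv⟩ := mem_iUnion₂.1 (ht hα)
  exact mem_iUnion₂.2 ⟨v, hv, subset_closure hαv⟩

theorem isCompact_le_norm {Y : Type*} [TopologicalSpace Y] (f : C₀(Y, ℂ)) {δ : ℝ} (hδ : 0 < δ) :
    IsCompact {v | δ ≤ ‖f v‖} := by
  have h0 := (ZeroAtInftyContinuousMap.zero_at_infty' f).norm
  rw [norm_zero] at h0
  obtain ⟨L, hL, hLs⟩ := Filter.mem_cocompact.1 (h0.eventually (gt_mem_nhds hδ))
  refine hL.of_isClosed_subset (isClosed_le continuous_const (map_continuous f).norm)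
    fun v hv => ?_
  by_contra hvL
  exact absurd (show δ ≤ ‖f v‖ from hv) (not_le.2 (hLs hvL))

theorem idealOf_finiteEmitters_subset (Q : TopologicalQuiver E0 E1) :
    idealOf Q.finiteEmitters ⊆ Q.J := by
  intro f hf
  refine (isClosed_J Q).closure_subset (Metric.mem_closure_iff.2 fun ε hε => ?_)
  have hK := isCompact_le_norm f (half_pos hε)
  obtain ⟨g, h1, -, h2, L, hL, hLU, hL0⟩ := exists_zeroAtInfty_bump hK
    (isOpen_finiteEmitters Q) (fun v hv => by
      by_contra hn
      have : ε / 2 ≤ ‖f v‖ := hv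
      rw [hf v hn, norm_zero] at this
      linarith)
  refine ⟨g * f, ?_, ?_⟩
  · refine mem_J_of_locallyInjective
      (isCompact_preimage_of_subset_finiteEmitters hL hLU) (fun α hα => ?_)
      fun α hα => exists_injOn_of_mem_finiteEmitters (hLU hα)
    rw [ZeroAtInftyContinuousMap.mul_apply, hL0 _ hα, zero_mul]
  · rw [dist_eq_norm]
    refine (norm_le_of_apply_le _ (half_pos hε).le fun v => ?_).trans_lt (half_lt_self hε)
    rw [ZeroAtInftyContinuousMap.sub_apply, ZeroAtInftyContinuousMap.mul_apply]
    have h3 : f v - g v * f v = (1 - g v) * f v := by ring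
    rw [h3, norm_mul]
    by_cases hv : ε / 2 ≤ ‖f v‖
    · rw [h1 v hv]; simpa using (half_pos hε).le
    · exact (mul_le_of_le_one_left (norm_nonneg _) (h2 v)).trans (not_le.1 hv).le

/-! ### Right linear operators and integral kernels -/

/-- Linearity with respect to the right action. -/
def IsRightLinear (T : Q.Corr →L[ℂ] Q.Corr) : Prop :=
  ∀ x f, T (Q.rightAction x f) = Q.rightAction (T x) f

theorem isRightLinear_φ (f : C₀(E0, ℂ)) : IsRightLinear (Q.φ f) := by
  intro x g
  induction x using corr_induction with
  | hc => exact isClosed_eq (by fun_prop) (by fun_prop)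
  | h ξ =>
    rw [rightAction_toCorr, φ_toCorr, φ_toCorr, rightAction_toCorr]
    congr 1
    ext α
    simp only [preMul_apply]
    ring

theorem isRightLinear_theta (x y : Q.Corr) : IsRightLinear (theta x y) := by
  intro z f
  rw [theta_apply, theta_apply, innerX_rightAction, rightAction_mul]

theorem norm_innerX_rightAction_self (x : Q.Corr) (g : C₀(E0, ℂ)) (v : E0) :
    ‖Q.innerX (Q.rightAction x g) (Q.rightAction x g) v‖ = ‖g v‖ ^ 2 * ‖Q.innerX x x v‖ := by
  rw [innerX_rightAction, ← star_innerX, innerX_rightAction]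
  simp only [ZeroAtInftyContinuousMap.mul_apply, ZeroAtInftyContinuousMap.star_apply, norm_mul,
    norm_star]
  ring

/-- A right linear operator is bounded fibrewise by its norm. -/
theorem IsRightLinear.norm_innerX_apply_le {T : Q.Corr →L[ℂ] Q.Corr} (hT : IsRightLinear T)
    (x : Q.Corr) (v : E0) :
    ‖Q.innerX (T x) (T x) v‖ ≤ ‖T‖ ^ 2 * ‖Q.innerX x x v‖ := by
  set c := ‖Q.innerX x x v‖ with hc
  have key : ∀ ε : ℝ, 0 < ε → ‖Q.innerX (T x) (T x) v‖ ≤ ‖T‖ ^ 2 * (c + ε) := fun ε hε => by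
    -- Right multiplication by `g` scales the fibre norms by `|g|`: nothing changes over `v`, while
    -- the global squared norm drops to at most `c + ε`. Right linearity carries the cutoff through
    -- `T`.
    obtain ⟨g, h1, hg, -, L, -, hLU, hL⟩ := exists_zeroAtInfty_bump (isCompact_singleton (x := v))
      (U := {w | ‖Q.innerX x x w‖ < c + ε})
      (isOpen_lt (map_continuous (Q.innerX x x)).norm continuous_const)
      (singleton_subset_iff.2 (lt_add_of_pos_right _ hε))
    have hx : ‖Q.innerX (Q.rightAction x g) (Q.rightAction x g)‖ ≤ c + ε := by
      refine norm_le_of_apply_le _ (by positivity) fun w => ?_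
      rw [norm_innerX_rightAction_self]
      by_cases hw : w ∈ L
      · exact (mul_le_of_le_one_left (norm_nonneg _)
          (pow_le_one₀ (norm_nonneg _) (hg w))).trans (le_of_lt (hLU hw))
      · rw [hL w hw, norm_zero]
        simpa using (by positivity : 0 ≤ c + ε)
    calc ‖Q.innerX (T x) (T x) v‖
        = ‖Q.innerX (Q.rightAction (T x) g) (Q.rightAction (T x) g) v‖ := by
          rw [norm_innerX_rightAction_self, h1 v rfl]; simp
      _ ≤ ‖Q.innerX (T (Q.rightAction x g)) (T (Q.rightAction x g))‖ := by
          rw [hT]; exact norm_apply_le _ v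
      _ = ‖T (Q.rightAction x g)‖ ^ 2 := (norm_sq_eq _).symm
      _ ≤ (‖T‖ * ‖Q.rightAction x g‖) ^ 2 := by
          gcongr; exact T.le_opNorm _
      _ = ‖T‖ ^ 2 * ‖Q.innerX (Q.rightAction x g) (Q.rightAction x g)‖ := by
          rw [mul_pow, norm_sq_eq (Q.rightAction x g)]
      _ ≤ ‖T‖ ^ 2 * (c + ε) := by gcongr
  have ht : Filter.Tendsto (fun ε : ℝ => ‖T‖ ^ 2 * (c + ε)) (𝓝[>] 0) (𝓝 (‖T‖ ^ 2 * (c + 0))) :=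
    ((continuous_const.mul (continuous_const.add continuous_id)).tendsto 0).mono_left
      nhdsWithin_le_nhds
  rw [add_zero] at ht
  exact ge_of_tendsto ht (Filter.eventually_of_mem self_mem_nhdsWithin key)

/-- `T` is right linear, and given by integration against a compactly supported kernel. -/
def HasKernel (T : Q.Corr →L[ℂ] Q.Corr) : Prop :=
  IsRightLinear T ∧ ∃ k : E1 × E1 → ℂ, Continuous k ∧ HasCompactSupport k ∧
    ∀ ξ : Q.PreModule, ∃ ζ : Q.PreModule, T (Q.toCorr ξ) = Q.toCorr ζ ∧
      ∀ β, ζ β = ∫ γ, k (β, γ) * ξ γ ∂(Q.lam (Q.r β))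

theorem integrable_kernel {k : E1 × E1 → ℂ} (hk : Continuous k) (ξ : Q.PreModule) (β : E1)
    (v : E0) : Integrable (fun γ => k (β, γ) * ξ γ) (Q.lam v) :=
  ((hk.comp (by fun_prop : Continuous fun γ => (β, γ))).mul
    ξ.continuous).integrable_of_hasCompactSupport ξ.hasCompactSupport.mul_left

theorem hasKernel_theta (ξ η : Q.PreModule) : HasKernel (theta (Q.toCorr ξ) (Q.toCorr η)) := by
  refine ⟨isRightLinear_theta _ _, fun p => ξ p.1 * star (η p.2), ?_, ?_, fun ζ =>
    ⟨_, theta_toCorr ξ η ζ, fun β => ?_⟩⟩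
  · exact (ξ.continuous.comp continuous_fst).mul (η.continuous.comp continuous_snd).star
  · refine HasCompactSupport.intro (K := tsupport ξ ×ˢ tsupport η)
      (ξ.hasCompactSupport.prod η.hasCompactSupport) fun p hp => ?_
    rw [mem_prod, not_and_or] at hp
    rcases hp with hp | hp
    · rw [image_eq_zero_of_notMem_tsupport hp, zero_mul]
    · rw [image_eq_zero_of_notMem_tsupport hp, star_zero, mul_zero]
  · rw [preMul_apply]
    change preInner η ζ (Q.r β) * ξ β = _
    rw [preInner_apply, ← integral_mul_const]
    congr 1
    ext γ
    ring

theorem hasKernel_zero : HasKernel (0 : Q.Corr →L[ℂ] Q.Corr) := by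
  refine ⟨fun x f => by simp, 0, continuous_const, HasCompactSupport.zero, fun ξ =>
    ⟨0, by simp, fun β => ?_⟩⟩
  simp only [Pi.zero_apply, zero_mul, integral_zero]
  rfl

theorem HasKernel.add {S T : Q.Corr →L[ℂ] Q.Corr} (hS : HasKernel S) (hT : HasKernel T) :
    HasKernel (S + T) := by
  obtain ⟨hS, k, hk, hkc, h⟩ := hS
  obtain ⟨hT, l, hl, hlc, h'⟩ := hT
  refine ⟨fun x f => by simp [hS x f, hT x f], k + l, hk.add hl, hkc.add hlc, fun ξ => ?_⟩
  obtain ⟨ζ, h1, h2⟩ := h ξ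
  obtain ⟨ζ', h1', h2'⟩ := h' ξ
  refine ⟨ζ + ζ', by simp [h1, h1'], fun β => ?_⟩
  rw [PreModule.add_apply, h2, h2', ← integral_add (integrable_kernel hk ξ _ _)
    (integrable_kernel hl ξ _ _)]
  congr 1
  ext γ
  simp [add_mul]

theorem HasKernel.smul {T : Q.Corr →L[ℂ] Q.Corr} (hT : HasKernel T) (c : ℂ) :
    HasKernel (c • T) := by
  obtain ⟨hT, k, hk, hkc, h⟩ := hT
  refine ⟨fun x f => by simp [hT x f], fun p => c * k p, continuous_const.mul hk,
    hkc.mul_left, fun ξ => ?_⟩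
  obtain ⟨ζ, h1, h2⟩ := h ξ
  refine ⟨c • ζ, by simp [h1], fun β => ?_⟩
  rw [PreModule.smul_apply, h2, ← integral_const_mul]
  congr 1
  ext γ
  ring

/-- Operators with a kernel form a subspace containing `Θ` of functions in `C_c(E¹)`; by density and
continuity of `Θ` its closure contains every `Θ`, hence all of `K(X)`. -/
theorem exists_hasKernel_of_mem_compacts {T : Q.Corr →L[ℂ] Q.Corr} (hT : T ∈ Q.compacts) {ε : ℝ}
    (hε : 0 < ε) : ∃ F, HasKernel F ∧ ‖T - F‖ < ε := by
  let S : Submodule ℂ (Q.Corr →L[ℂ] Q.Corr) :=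
    { carrier := {F | HasKernel F}
      add_mem' := HasKernel.add
      zero_mem' := hasKernel_zero
      smul_mem' := fun c _ h => h.smul c }
  have hcl : IsClosed (S.topologicalClosure : Set (Q.Corr →L[ℂ] Q.Corr)) :=
    Submodule.isClosed_topologicalClosure _
  have hle : Q.compacts ≤ S.topologicalClosure := by
    refine Submodule.topologicalClosure_minimal _ (Submodule.span_le.2 ?_) hcl
    rintro _ ⟨x, y, rfl⟩
    have hc : Continuous fun p : Q.Corr × Q.Corr => theta p.1 p.2 := by
      unfold theta
      fun_prop
    induction x using corr_induction with
    | hc => exact hcl.preimage (hc.comp (by fun_prop : Continuous fun x : Q.Corr => (x, y)))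
    | h ξ =>
      induction y using corr_induction with
      | hc =>
        exact hcl.preimage (hc.comp (by fun_prop : Continuous fun y : Q.Corr => (Q.toCorr ξ, y)))
      | h η => exact Submodule.le_topologicalClosure S (hasKernel_theta ξ η)
  obtain ⟨F, hF, h⟩ := Metric.mem_closure_iff.1 (hle hT) ε hε
  exact ⟨F, hF, by rwa [← dist_eq_norm]⟩

/-- If `φ f` is compact then it is fibrewise close to an integral operator with a continuous,
compactly supported kernel. -/
theorem exists_kernel_of_mem_J {f : C₀(E0, ℂ)} (hf : f ∈ Q.J) {ε : ℝ} (hε : 0 < ε) :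
    ∃ k : E1 × E1 → ℂ, Continuous k ∧ HasCompactSupport k ∧
      ∀ ξ : Q.PreModule, ∃ ζ : Q.PreModule,
        (∀ β, ζ β = f (Q.s β) * ξ β - ∫ γ, k (β, γ) * ξ γ ∂(Q.lam (Q.r β))) ∧
        ∀ v, fiberSq ζ v ≤ ε ^ 2 * fiberSq ξ v := by
  obtain ⟨F, ⟨hFr, k, hk, hkc, h⟩, hFε⟩ := exists_hasKernel_of_mem_compacts hf hε
  refine ⟨k, hk, hkc, fun ξ => ?_⟩
  obtain ⟨ζ, h1, h2⟩ := h ξ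
  refine ⟨preMul ⟨Q.s, Q.continuous_s⟩ f ξ + (-1 : ℂ) • ζ, fun β => ?_, fun v => ?_⟩
  · rw [PreModule.add_apply, PreModule.smul_apply, h2, preMul_apply]
    simp [sub_eq_add_neg]
  · have hD : IsRightLinear (Q.φ f - F) := fun x g => by
      simp [isRightLinear_φ f x g, hFr x g]
    have h3 := hD.norm_innerX_apply_le (Q.toCorr ξ) v
    have h4 : (Q.φ f - F) (Q.toCorr ξ) =
        Q.toCorr (preMul ⟨Q.s, Q.continuous_s⟩ f ξ + (-1 : ℂ) • ζ) := by
      rw [sub_apply, φ_toCorr, h1, map_add, map_smul]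
      simp [sub_eq_add_neg]
    rw [h4, innerX_toCorr, innerX_toCorr, norm_preInner_self_apply,
      norm_preInner_self_apply] at h3
    refine h3.trans ?_
    have : 0 ≤ fiberSq ξ v := integral_nonneg fun α => by positivity
    gcongr

/-! ### Compactness of the left action -/

/-- The set lies inside the first projection of the support of an approximating kernel: a bump
outside it would be multiplied by more than `3δ/4`, against a fibrewise bound of `δ/2`. -/
theorem isCompact_of_mem_J {f : C₀(E0, ℂ)} (hf : f ∈ Q.J) {δ : ℝ} (hδ : 0 < δ) :
    IsCompact {α | δ ≤ ‖f (Q.s α)‖} := by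
  have hfs : Continuous fun α => ‖f (Q.s α)‖ := ((map_continuous f).comp Q.continuous_s).norm
  obtain ⟨k, hk, hkc, h⟩ := exists_kernel_of_mem_J hf (half_pos hδ)
  have hL : IsCompact (Prod.fst '' tsupport k) := IsCompact.image hkc continuous_fst
  refine hL.of_isClosed_subset (isClosed_le continuous_const hfs) fun α hα => ?_
  by_contra hαL
  obtain ⟨g, h1, hc, hs, -⟩ := exists_continuousMap_one_of_isCompact_subset_isOpen
    (isCompact_singleton (x := α))
    (V := (Prod.fst '' tsupport k)ᶜ ∩ {β | 3 * δ / 4 < ‖f (Q.s β)‖})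
    (hL.isClosed.isOpen_compl.inter (isOpen_lt continuous_const hfs))
    (singleton_subset_iff.2 ⟨hαL, by
      have : δ ≤ ‖f (Q.s α)‖ := hα
      change 3 * δ / 4 < _
      linarith⟩)
  have hc : HasCompactSupport g := hc
  obtain ⟨ζ, hζ, hle⟩ := h (Q.ofRealPre g hc)
  set ξ := Q.ofRealPre g hc with hξ
  have hpos : 0 < fiberSq ξ (Q.r α) := fiberSq_pos (by
    rw [hξ, ofRealPre_apply, h1 rfl]; simp)
  have hlow : (3 * δ / 4) ^ 2 * fiberSq ξ (Q.r α) ≤ fiberSq ζ (Q.r α) := by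
    rw [fiberSq, fiberSq, ← integral_const_mul]
    refine integral_mono ((integrable_norm_sq ξ _).const_mul _) (integrable_norm_sq ζ _)
      fun β => ?_
    by_cases hβ : β ∈ tsupport g
    · have hk0 : ∀ γ, k (β, γ) = 0 := fun γ =>
        image_eq_zero_of_notMem_tsupport fun hn => (hs hβ).1 ⟨_, hn, rfl⟩
      have h2 : 3 * δ / 4 < ‖f (Q.s β)‖ := (hs hβ).2
      simp only [hζ, hk0, zero_mul, integral_zero, sub_zero, norm_mul, mul_pow]
      gcongr
    · have : ξ β = 0 := by
        rw [hξ, ofRealPre_apply, image_eq_zero_of_notMem_tsupport hβ]; simp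
      simp only [this, norm_zero, ne_eq, OfNat.ofNat_ne_zero, not_false_eq_true, zero_pow, mul_zero]
      positivity
  nlinarith [hle (Q.r α), mul_pos (mul_pos hδ hδ) hpos]

/-- Cauchy–Schwarz against a function that is `1` on the support. -/
theorem sq_integral_norm_le {χ ξ : Q.PreModule} (h : ∀ β, ξ β ≠ 0 → χ β = 1) {M : ℝ}
    (hM : 0 < M) {v : E0} (hχ : fiberSq χ v ≤ M) :
    (∫ β, ‖ξ β‖ ∂(Q.lam v)) ^ 2 ≤ M * fiberSq ξ v := by
  set S := ∫ β, ‖ξ β‖ ∂(Q.lam v) with hS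
  have hi : Integrable (fun β => ‖ξ β‖) (Q.lam v) :=
    ξ.continuous.norm.integrable_of_hasCompactSupport ξ.hasCompactSupport.norm
  -- The integrand is the square of `‖ξ‖ - (S / M) ‖χ‖`, since `χ = 1` where `ξ ≠ 0`; `S / M` is the
  -- optimal coefficient.
  have key : 0 ≤ ∫ β, (‖ξ β‖ ^ 2 - 2 * (S / M) * ‖ξ β‖ + (S / M) ^ 2 * ‖χ β‖ ^ 2) ∂(Q.lam v) := by
    refine integral_nonneg fun β => ?_
    by_cases hβ : ξ β = 0
    · have : 0 ≤ (S / M) ^ 2 * ‖χ β‖ ^ 2 := by positivity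
      simpa [hβ] using this
    · simp only [h β hβ, norm_one, Pi.zero_apply]
      nlinarith [sq_nonneg (‖ξ β‖ - S / M)]
  rw [integral_add (f := fun β => ‖ξ β‖ ^ 2 - 2 * (S / M) * ‖ξ β‖)
      ((integrable_norm_sq ξ v).sub (hi.const_mul _))
      ((integrable_norm_sq χ v).const_mul _),
    integral_sub (integrable_norm_sq ξ v) (hi.const_mul _), integral_const_mul,
    integral_const_mul, ← hS] at key
  change 0 ≤ fiberSq ξ v - 2 * (S / M) * S + (S / M) ^ 2 * fiberSq χ v at key
  have h2 : (S / M) ^ 2 * fiberSq χ v ≤ (S / M) ^ 2 * M := by gcongr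
  have h3 : M * (S / M) = S := by field_simp
  nlinarith [mul_le_mul_of_nonneg_left (key.trans (add_le_add_right h2 _)) hM.le]

theorem exists_pos_fiberSq_le (χ : Q.PreModule) : ∃ M, 0 < M ∧ ∀ v, fiberSq χ v ≤ M :=
  ⟨‖preInner χ χ‖ + 1, by positivity, fun v => by
    rw [← norm_preInner_self_apply]
    linarith [norm_apply_le (preInner χ χ) v]⟩

/-- If `r` identifies two edges of `U`, then there is a nonzero function supported in `U` with
integral zero on the fibre. -/
theorem exists_integral_eq_zero {U : Set E1} (hU : IsOpen U) {β γ : E1} (hβ : β ∈ U) (hγ : γ ∈ U)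
    (hne : β ≠ γ) (hr : Q.r β = Q.r γ) :
    ∃ ξ : Q.PreModule, (∀ α, α ∉ U → ξ α = 0) ∧ ∫ α, ξ α ∂(Q.lam (Q.r γ)) = 0 ∧ ξ γ ≠ 0 := by
  -- The bump at `β` avoids `γ`, so `b g₁ - a g₂`, with `a` and `b` the fibre integrals, takes the
  -- nonzero value `-a` at `γ`.
  obtain ⟨g₁, h₁, hc₁, hs₁, h01₁⟩ := exists_continuousMap_one_of_isCompact_subset_isOpen
    (isCompact_singleton (x := β)) (hU.inter isOpen_compl_singleton)
    (singleton_subset_iff.2 ⟨hβ, hne⟩ : {β} ⊆ U ∩ {γ}ᶜ)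
  obtain ⟨g₂, h₂, hc₂, hs₂, h01₂⟩ := exists_continuousMap_one_of_isCompact_subset_isOpen
    (isCompact_singleton (x := γ)) hU (singleton_subset_iff.2 hγ)
  have hc₁ : HasCompactSupport g₁ := hc₁
  have hc₂ : HasCompactSupport g₂ := hc₂
  have i₁ : Integrable g₁ (Q.lam (Q.r γ)) := g₁.continuous.integrable_of_hasCompactSupport hc₁
  have i₂ : Integrable g₂ (Q.lam (Q.r γ)) := g₂.continuous.integrable_of_hasCompactSupport hc₂
  set a := ∫ α, g₁ α ∂(Q.lam (Q.r γ)) with ha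
  set b := ∫ α, g₂ α ∂(Q.lam (Q.r γ)) with hb
  have ha0 : 0 < a := by
    rw [ha, ← hr]
    refine integral_lam_pos g₁.continuous hc₁ (fun α => (h01₁ α).1) (α := β) ?_
    rw [h₁ rfl]; exact one_ne_zero
  have hc : HasCompactSupport fun α => b * g₁ α - a * g₂ α :=
    (hc₁.mul_left (f := fun _ => b)).sub (hc₂.mul_left (f := fun _ => a))
  refine ⟨Q.ofRealPre ⟨fun α => b * g₁ α - a * g₂ α, by fun_prop⟩ hc, fun α hα => ?_, ?_, ?_⟩
  · rw [ofRealPre_apply]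
    simp [image_eq_zero_of_notMem_tsupport fun hn => hα (hs₁ hn).1,
      image_eq_zero_of_notMem_tsupport fun hn => hα (hs₂ hn)]
  · simp only [ofRealPre_apply, ContinuousMap.coe_mk]
    rw [integral_complex_ofReal, integral_sub (i₁.const_mul _) (i₂.const_mul _),
      integral_const_mul, integral_const_mul, ← ha, ← hb]
    simp [mul_comm]
  · rw [ofRealPre_apply]
    have : g₁ γ = 0 := image_eq_zero_of_notMem_tsupport fun hn => (hs₁ hn).2 rfl
    simp [this, h₂ (mem_singleton γ), ha0.ne']

theorem exists_injOn_of_mem_J {f : C₀(E0, ℂ)} (hf : f ∈ Q.J) {α : E1} (hα : f (Q.s α) ≠ 0) :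
    ∃ U ∈ 𝓝 α, InjOn Q.r U := by
  set a := ‖f (Q.s α)‖ with ha
  have ha0 : 0 < a := norm_pos_iff.2 hα
  have hfs : Continuous fun α => ‖f (Q.s α)‖ := ((map_continuous f).comp Q.continuous_s).norm
  obtain ⟨k, hk, -, h⟩ := exists_kernel_of_mem_J hf (by positivity : 0 < a / 4)
  obtain ⟨K, hK, hKα⟩ := exists_compact_mem_nhds α
  obtain ⟨g, h1, hc, -, -⟩ := exists_continuousMap_one_of_isCompact_subset_isOpen hK isOpen_univ
    (subset_univ _)
  have hc : HasCompactSupport g := hc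
  set χ := Q.ofRealPre g hc with hχ
  obtain ⟨M, hM0, hM⟩ := exists_pos_fiberSq_le χ
  -- Chosen so that `η M = a / 4`: the kernel term then costs no more than the approximation error
  -- `a / 4`, and the contradiction is `9/16 ≤ 2/16 + 2/16`.
  set η := a / (4 * M) with hη
  have hη0 : 0 < η := by positivity
  have hkα : {p | ‖k p - k (α, α)‖ < η} ∈ 𝓝 (α, α) :=
    (isOpen_lt (hk.sub continuous_const).norm continuous_const).mem_nhds (by simpa using hη0)
  obtain ⟨U₁, U₂, hU₁, hα₁, hU₂, hα₂, hU⟩ := mem_nhds_prod_iff'.1 hkα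
  set U := (U₁ ∩ U₂) ∩ (interior K ∩ {β | 3 * a / 4 < ‖f (Q.s β)‖}) with hUdef
  have hUo : IsOpen U := (hU₁.inter hU₂).inter
    (isOpen_interior.inter (isOpen_lt continuous_const hfs))
  refine ⟨U, hUo.mem_nhds ⟨⟨hα₁, hα₂⟩, mem_interior_iff_mem_nhds.2 hKα, ?_⟩, ?_⟩
  · change 3 * a / 4 < a
    linarith
  intro β hβ γ hγ hr
  by_contra hne
  obtain ⟨ξ, hξU, hξ0, hξγ⟩ := exists_integral_eq_zero hUo hβ hγ hne hr
  obtain ⟨ζ, hζ, hle⟩ := h ξ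
  set v := Q.r γ with hv
  set S := ∫ β, ‖ξ β‖ ∂(Q.lam v) with hS
  have hi : Integrable (fun β => ‖ξ β‖) (Q.lam v) :=
    ξ.continuous.norm.integrable_of_hasCompactSupport ξ.hasCompactSupport.norm
  have hξi : Integrable ξ (Q.lam v) :=
    ξ.continuous.integrable_of_hasCompactSupport ξ.hasCompactSupport
  have hpos : 0 < fiberSq ξ v := fiberSq_pos hξγ
  have hχ1 : ∀ β, ξ β ≠ 0 → χ β = 1 := fun β hβ => by
    have hβU : β ∈ U := by
      by_contra hn
      exact hβ (hξU β hn)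
    rw [hχ, ofRealPre_apply, h1 (interior_subset hβU.2.1)]; simp
  have hCS : S ^ 2 ≤ M * fiberSq ξ v := sq_integral_norm_le hχ1 hM0 (hM v)
  have hint : ∀ β ∈ U, ‖∫ γ, k (β, γ) * ξ γ ∂(Q.lam v)‖ ≤ η * S := fun β hβ => by
    -- The constant `k (α, α)` can be subtracted for free because `ξ` has mean zero on the fibre.
    have h2 : ∫ γ, k (β, γ) * ξ γ ∂(Q.lam v) =
        ∫ γ, (k (β, γ) - k (α, α)) * ξ γ ∂(Q.lam v) := by
      simp only [sub_mul]
      rw [integral_sub (integrable_kernel hk ξ β v) (hξi.const_mul _), integral_const_mul, hξ0,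
        mul_zero, sub_zero]
    rw [h2, hS, ← integral_const_mul]
    refine norm_integral_le_of_norm_le (hi.const_mul _) (Filter.Eventually.of_forall fun γ => ?_)
    rw [norm_mul]
    by_cases hγ : γ ∈ U
    · have h3 : ‖k (β, γ) - k (α, α)‖ < η := hU (mk_mem_prod hβ.1.1 hγ.1.2)
      gcongr
    · simp [hξU γ hγ]
  -- Only almost everywhere: the formula for `ζ β` integrates over the fibre of `r β`, which is that
  -- of `v` for almost every `β`.
  have hae : ∀ᵐ β ∂(Q.lam v), (3 * a / 4) ^ 2 * ‖ξ β‖ ^ 2 ≤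
      2 * ‖ζ β‖ ^ 2 + 2 * (η * S) ^ 2 * ‖χ β‖ ^ 2 := by
    refine (ae_r_eq v).mono fun β hβ => ?_
    by_cases hξβ : ξ β = 0
    · rw [hξβ, norm_zero]
      have : 0 ≤ 2 * ‖ζ β‖ ^ 2 + 2 * (η * S) ^ 2 * ‖χ β‖ ^ 2 := by positivity
      simpa using this
    · have hβU : β ∈ U := by
        by_contra hn
        exact hξβ (hξU β hn)
      have h2 := hint β hβU
      have h3 : f (Q.s β) * ξ β = ζ β + ∫ γ, k (β, γ) * ξ γ ∂(Q.lam v) := by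
        rw [hζ, hβ]; ring
      have h4 : 3 * a / 4 < ‖f (Q.s β)‖ := hβU.2.2
      have h5 : (3 * a / 4) * ‖ξ β‖ ≤ ‖ζ β‖ + η * S := by
        calc (3 * a / 4) * ‖ξ β‖ ≤ ‖f (Q.s β)‖ * ‖ξ β‖ := by gcongr
          _ = ‖ζ β + ∫ γ, k (β, γ) * ξ γ ∂(Q.lam v)‖ := by rw [← norm_mul, h3]
          _ ≤ ‖ζ β‖ + η * S := (norm_add_le _ _).trans (by gcongr)
      have h6 : ((3 * a / 4) * ‖ξ β‖) ^ 2 ≤ (‖ζ β‖ + η * S) ^ 2 := by gcongr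
      rw [hχ1 β hξβ, norm_one]
      nlinarith [sq_nonneg (‖ζ β‖ - η * S)]
  have hfin := integral_mono_ae ((integrable_norm_sq ξ v).const_mul ((3 * a / 4) ^ 2))
    (((integrable_norm_sq ζ v).const_mul 2).add
      ((integrable_norm_sq χ v).const_mul (2 * (η * S) ^ 2))) hae
  simp only [Pi.add_apply] at hfin
  rw [integral_const_mul, integral_add ((integrable_norm_sq ζ v).const_mul 2)
      ((integrable_norm_sq χ v).const_mul (2 * (η * S) ^ 2)), integral_const_mul,
    integral_const_mul] at hfin
  change (3 * a / 4) ^ 2 * fiberSq ξ v ≤ 2 * fiberSq ζ v + 2 * (η * S) ^ 2 * fiberSq χ v at hfin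
  have hηM : η * M = a / 4 := by rw [hη]; field_simp
  have h7 : 2 * (η * S) ^ 2 * fiberSq χ v ≤ 2 * (a / 4) ^ 2 * fiberSq ξ v :=
    calc 2 * (η * S) ^ 2 * fiberSq χ v ≤ 2 * (η * S) ^ 2 * M := by gcongr; exact hM v
      _ = 2 * η ^ 2 * M * S ^ 2 := by ring
      _ ≤ 2 * η ^ 2 * M * (M * fiberSq ξ v) := by gcongr
      _ = 2 * (η * M) ^ 2 * fiberSq ξ v := by ring
      _ = 2 * (a / 4) ^ 2 * fiberSq ξ v := by rw [hηM]
  nlinarith [hle v, mul_pos (mul_pos ha0 ha0) hpos]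

/-! ### Identification of the ideals -/

theorem mem_finiteEmitters_of_mem_J {f : C₀(E0, ℂ)} (hf : f ∈ Q.J) {v : E0} (hv : f v ≠ 0) :
    v ∈ Q.finiteEmitters := by
  have hfc : Continuous fun w => ‖f w‖ := (map_continuous f).norm
  -- Half the value at `v` keeps `|f| ≥ δ > 0` even on the closure of `V`, where both compactness
  -- statements apply.
  set δ := ‖f v‖ / 2 with hδ
  have hδ0 : 0 < δ := half_pos (norm_pos_iff.2 hv)
  set V := {w | δ < ‖f w‖} with hV
  have hVo : IsOpen V := isOpen_lt continuous_const hfc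
  have hcl : closure V ⊆ {w | δ ≤ ‖f w‖} :=
    closure_minimal (fun w (hw : δ < ‖f w‖) => hw.le) (isClosed_le continuous_const hfc)
  refine ⟨V, hVo.mem_nhds (half_lt_self (norm_pos_iff.2 hv)), ?_, ?_, ?_⟩
  · exact (isCompact_le_norm f hδ0).of_isClosed_subset isClosed_closure hcl
  · exact (isCompact_of_mem_J hf hδ0).of_isClosed_subset
      (isClosed_closure.preimage Q.continuous_s) fun α hα => hcl hα
  · rw [isLocalHomeomorph_iff_isOpenEmbedding_restrict]
    rintro ⟨α, hα⟩
    have hα' : δ < ‖f (Q.s α)‖ := hα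
    obtain ⟨U, hU, hi⟩ := exists_injOn_of_mem_J hf (norm_pos_iff.1 (hδ0.trans hα'))
    have hSo : IsOpen (Q.s ⁻¹' V) := hVo.preimage Q.continuous_s
    refine ⟨Subtype.val ⁻¹' interior U, (isOpen_interior.preimage continuous_subtype_val).mem_nhds
      (mem_interior_iff_mem_nhds.2 hU), IsOpenEmbedding.of_continuous_injective_isOpenMap
      ?_ ?_ ?_⟩
    · exact (Q.continuous_r.comp continuous_subtype_val).comp continuous_subtype_val
    · rintro ⟨⟨β, hβ⟩, hβU⟩ ⟨⟨γ, hγ⟩, hγU⟩ hβγ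
      have : β = γ := hi (interior_subset hβU) (interior_subset hγU) hβγ
      subst this
      rfl
    · exact (Q.isOpenMap_r.domRestrict hSo).domRestrict
        (isOpen_interior.preimage continuous_subtype_val)

theorem J_eq (Q : TopologicalQuiver E0 E1) : Q.J = idealOf Q.finiteEmitters :=
  Subset.antisymm (fun _ hf _ hv => by_contra fun h => hv (mem_finiteEmitters_of_mem_J hf h))
    (idealOf_finiteEmitters_subset Q)

theorem fin_eq (Q : TopologicalQuiver E0 E1) : Q.fin = Q.finiteEmitters := by
  rw [fin, J_eq, openSet_idealOf (isOpen_finiteEmitters Q)]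

theorem isOpen_sinks (Q : TopologicalQuiver E0 E1) : IsOpen Q.sinks := by
  rw [sinks_eq]
  exact isClosed_closure.isOpen_compl

theorem JX_eq (Q : TopologicalQuiver E0 E1) : Q.JX = idealOf Q.reg := by
  rw [JX, kerφ_eq, ← sinks_eq, annihilator_idealOf (isOpen_sinks Q), J_eq, reg, fin_eq]
  ext f
  constructor
  · rintro ⟨h1, h2⟩ v hv
    by_cases hvf : v ∈ Q.finiteEmitters
    · exact h2 v fun hn => hv ⟨hvf, hn⟩
    · exact h1 v hvf
  · exact fun h => ⟨fun v hv => h v fun hn => hv hn.1, fun v hv => h v fun hn => hv hn.2⟩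

end TopologicalQuiver

end

theorem mainTheorem8 {E0 E1 : Type*}
    [TopologicalSpace E0] [T2Space E0] [LocallyCompactSpace E0] [SecondCountableTopology E0]
    [TopologicalSpace E1] [T2Space E1] [LocallyCompactSpace E1] [SecondCountableTopology E1]
    [MeasurableSpace E1] [BorelSpace E1] (Q : TopologicalQuiver E0 E1) :
    ((IsOpen Q.sinks ∧ Q.kerφ = TopologicalQuiver.idealOf Q.sinks) ∧
      (IsOpen Q.fin ∧ Q.J = TopologicalQuiver.idealOf Q.fin) ∧
      (IsOpen Q.reg ∧ Q.JX = TopologicalQuiver.idealOf Q.reg)) ∧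
    Q.sinks = (closure (Set.range Q.s))ᶜ ∧
    Q.fin = {v | ∃ V ∈ 𝓝 v, IsCompact (closure V) ∧ IsCompact (Q.s ⁻¹' closure V) ∧
      IsLocalHomeomorph ((Q.s ⁻¹' V).domRestrict Q.r)} ∧
    Q.reg = {v | ∃ V ∈ 𝓝 v, IsCompact (closure V) ∧ IsCompact (Q.s ⁻¹' closure V) ∧
      IsLocalHomeomorph ((Q.s ⁻¹' V).domRestrict Q.r)} ∩ interior (closure (Set.range Q.s)) := by
  have hfin : IsOpen Q.fin := by
    rw [Q.fin_eq]
    exact Q.isOpen_finiteEmitters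
  refine ⟨⟨⟨Q.isOpen_sinks, ?_⟩, ⟨hfin, ?_⟩, hfin.sdiff isClosed_closure, Q.JX_eq⟩,
    Q.sinks_eq, Q.fin_eq, ?_⟩
  · rw [Q.sinks_eq, Q.kerφ_eq]
  · rw [Q.fin_eq, Q.J_eq]
  -- The closure of the sinks is the complement of the interior of the closure of `s(E¹)`.
  · rw [TopologicalQuiver.reg, Q.fin_eq, Q.sinks_eq, closure_compl, Set.sdiff_eq, compl_compl]
    rfl
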